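/- All graphs are simple and undirected, and may be finite or infinite. For a graph $G$, the geodesic interval $I_G(x,y)$ is the set of vertices lying on shortest $(x,y)$-paths; a set $C\subseteq V(G)$ is convex if $I_G(x,y)\subseteq C$ for all $x,y\in C$; a half-space of $G$ is a convex set $H\subseteq V(G)$ such that $V(G)\setminus H$ is also convex; a convex subgraph of $G$ is an induced subgraph whose vertex set is convex. A copoint at a vertex $x$ is a convex set $K$ that is maximal, with respect to inclusion, among the convex sets not containing $x$; $x$ is then called an attaching point of $K$; a copoint of $G$ is a copoint at some vertex, and $\mathrm{Att}(K)$ denotes the set of all attaching points of the copoint $K$. The graph $G$ is Att-convex if $\mathrm{Att}(K)$ is convex for every copoint $K$ of $G$. A partial cube is a connected graph isomorphic to an isometric (distance-preserving) subgraph of some hypercube, where the hypercube over a (finite or infinite) set $I$ has the finite subsets of $I$ as vertices, two of them being adjacent if their symmetric difference has exactly one element. Proposition. Let $G$ be a connected bipartite graph. The following assertions are equivalent: (i) $G$ is a partial cube. (ii) $G$ is Att-convex. (iii) For every convex subgraph $F$ of $G$, every inclusion-maximal proper convex subset of $V(F)$ (with respect to the geodesic convexity of $F$) is a half-space of $F$.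 -/

import Mathlib

universe u

namespace GeodesicConvexity

/-- The geodesic interval between `x` and `y`: the vertices of all shortest `(x, y)`-paths
(a walk whose length is the distance of its ends is automatically a path). -/
def interval {V : Type u} (G : SimpleGraph V) (x y : V) : Set V :=
  {z | ∃ p : G.Walk x y, p.length = G.dist x y ∧ z ∈ p.support}

/-- Geodesically convex sets of vertices. -/
def IsConvex {V : Type u} (G : SimpleGraph V) (C : Set V) : Prop :=
  ∀ x ∈ C, ∀ y ∈ C, interval G x y ⊆ C

/-- Half-spaces: convex sets whose complement is convex. -/
def IsHalfSpace {V : Type u} (G : SimpleGraph V) (H : Set V) : Prop :=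
  IsConvex G H ∧ IsConvex G Hᶜ

/-- `K` is a copoint at `x`: a convex set that is maximal, for inclusion, among the convex sets
that do not contain `x`. -/
def IsCopointAt {V : Type u} (G : SimpleGraph V) (K : Set V) (x : V) : Prop :=
  Maximal (fun C : Set V => IsConvex G C ∧ x ∉ C) K

/-- `K` is a copoint: a copoint at some vertex. -/
def IsCopoint {V : Type u} (G : SimpleGraph V) (K : Set V) : Prop :=
  ∃ x, IsCopointAt G K x

/-- The set of all attaching points of `K`. -/
def Att {V : Type u} (G : SimpleGraph V) (K : Set V) : Set V :=
  {x | IsCopointAt G K x}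

/-- Att-convexity: the set of attaching points of every copoint is convex. -/
def IsAttConvex {V : Type u} (G : SimpleGraph V) : Prop :=
  ∀ K : Set V, IsCopoint G K → IsConvex G (Att G K)

/-- A convex subgraph: an induced subgraph whose vertex set is convex. -/
def IsConvexSubgraph {V : Type u} (G : SimpleGraph V) (F : G.Subgraph) : Prop :=
  F.IsInduced ∧ IsConvex G F.verts

/-- `K` is a maximal proper convex subset of the vertex set of `G`. -/
def IsMaximalProperConvex {V : Type u} (G : SimpleGraph V) (K : Set V) : Prop :=
  Maximal (fun C : Set V => IsConvex G C ∧ C ≠ Set.univ) K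

/-- The hypercube of (possibly infinite) dimension `ι`: the vertices are the finite subsets of
`ι`, two of them being adjacent when they differ in exactly one element. -/
def hypercube (ι : Type u) : SimpleGraph (Finset ι) where
  Adj A B := (symmDiff (A : Set ι) (B : Set ι)).encard = 1
  symm := ⟨fun A B h => by rwa [symmDiff_comm]⟩
  loopless := ⟨fun A h => by simp at h⟩

/-- Partial cubes: connected graphs isomorphic to an isometric subgraph of a hypercube. -/
def IsPartialCube {V : Type u} (G : SimpleGraph V) : Prop :=
  G.Connected ∧ ∃ (ι : Type u) (f : G ↪g hypercube ι),
    ∀ x y : V, (hypercube ι).dist (f x) (f y) = G.dist x y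

end GeodesicConvexity

namespace GeodesicConvexity

variable {V : Type u} {G : SimpleGraph V}

/-! ### Distances in connected and bipartite graphs -/

/-! Everything turns on the sets W_ab = `nearer G a b` for edges ab. Bipartiteness makes W_ab and
W_ba complementary, and a connected bipartite graph is a partial cube exactly when all W_ab are
convex (Djoković).

(i) ⇒ (iii): if K is nonempty, maximal proper convex in F, some edge yw of F leaves K; convexity
puts K inside W_yw, so K is the trace of W_yw on F. (iii) ⇒ (ii): for a copoint K at x, Att(K) is H
\ K with H the hull of K ∪ {x}, and K is maximal proper convex in H.

(ii) ⇒ (i) is the hard part. If some W_ab is not convex, take w ∉ W_ab on a geodesic between u, v ∈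
W_ab, minimising the perimeter P of a, u, v and then d(u, v). The neighbours u', v' of u, v towards
w lie in W_ba, and b, u', v' has perimeter below P. Below P the sets W_pq behave as in a partial
cube, so b, u', v' lie in a convex set S embedded isometrically in a cube of dimension half their
perimeter (`IsCubeEmb.exists_extend_geodesic`, `IsCubeEmb.exists_isConvex`). That cube has no room
for a triangle of perimeter P, so a ∉ S. A copoint K ⊇ S at a then has u and v as attaching points,
while u' ∈ K lies between them: Att(K) is not convex. -/

theorem mem_interval_iff (hc : G.Connected) {x y z : V} :
    z ∈ interval G x y ↔ G.dist x z + G.dist z y = G.dist x y := by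
  classical
  constructor
  · rintro ⟨p, hp, hz⟩
    have h1 := SimpleGraph.dist_le (p.takeUntil z hz)
    have h2 := SimpleGraph.dist_le (p.dropUntil z hz)
    have h3 : (p.takeUntil z hz).length + (p.dropUntil z hz).length = p.length := by
      rw [← SimpleGraph.Walk.length_append, p.take_spec hz]
    have h4 := hc.dist_triangle (u := x) (v := z) (w := y)
    omega
  · intro h
    obtain ⟨p, hp⟩ := hc.exists_walk_length_eq_dist x z
    obtain ⟨q, hq⟩ := hc.exists_walk_length_eq_dist z y
    refine ⟨p.append q, by rw [SimpleGraph.Walk.length_append]; omega, ?_⟩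
    rw [SimpleGraph.Walk.mem_support_append_iff]
    exact Or.inl p.end_mem_support

theorem isConvex_iff (hc : G.Connected) {C : Set V} :
    IsConvex G C ↔ ∀ x ∈ C, ∀ y ∈ C, ∀ z, G.dist x z + G.dist z y = G.dist x y → z ∈ C := by
  simp only [IsConvex, Set.subset_def, mem_interval_iff hc]

theorem exists_adj_dist_add_one (hc : G.Connected) {s z : V} (h : s ≠ z) :
    ∃ w, G.Adj s w ∧ G.dist w z + 1 = G.dist s z := by
  obtain ⟨p, hp⟩ := hc.exists_walk_length_eq_dist s z
  cases p with
  | nil => exact absurd rfl h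
  | @cons _ w _ hadj q =>
    refine ⟨w, hadj, ?_⟩
    have h1 := SimpleGraph.dist_le q
    have h2 := hc.dist_triangle (u := s) (v := w) (w := z)
    rw [SimpleGraph.dist_eq_one_iff_adj.2 hadj] at h2
    rw [SimpleGraph.Walk.length_cons] at hp
    omega

theorem dist_le_succ_of_adj (hc : G.Connected) {a b : V} (h : G.Adj a b) (x : V) :
    G.dist x b ≤ G.dist x a + 1 := by
  have := hc.dist_triangle (u := x) (v := a) (w := b)
  rwa [SimpleGraph.dist_eq_one_iff_adj.2 h] at this

/-- In a 2-colouring, the colours of the ends of a walk determine the parity of its length. -/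
theorem dist_ne_of_adj (hc : G.Connected) (hb : G.IsBipartite) {a b : V} (h : G.Adj a b) (x : V) :
    G.dist x a ≠ G.dist x b := by
  have c : G.Coloring Bool := SimpleGraph.Colorable.toColoring hb (by simp)
  obtain ⟨p, hp⟩ := hc.exists_walk_length_eq_dist x a
  obtain ⟨q, hq⟩ := hc.exists_walk_length_eq_dist x b
  have h1 := c.even_length_iff_congr p
  have h2 := c.even_length_iff_congr q
  have h3 := c.valid h
  intro h4
  rw [hp, h4, ← hq, h2] at h1
  apply h3
  cases hx : c x <;> cases ha : c a <;> cases hb : c b <;> simp_all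

theorem dist_adj_cases (hc : G.Connected) (hb : G.IsBipartite) {a b : V} (h : G.Adj a b) (x : V) :
    G.dist x b = G.dist x a + 1 ∨ G.dist x a = G.dist x b + 1 := by
  have h1 := dist_ne_of_adj hc hb h x
  have h2 := dist_le_succ_of_adj hc h x
  have h3 := dist_le_succ_of_adj hc h.symm x
  omega

/-- The vertices nearer to `a` than to `b`. -/
def nearer (G : SimpleGraph V) (a b : V) : Set V := {x | G.dist x a < G.dist x b}

theorem compl_nearer (hc : G.Connected) (hb : G.IsBipartite) {a b : V} (h : G.Adj a b) :
    (nearer G a b)ᶜ = nearer G b a := by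
  ext x
  have := dist_ne_of_adj hc hb h x
  simp only [nearer, Set.mem_compl_iff, Set.mem_ofPred_eq]
  omega

/-! ### Hypercubes and partial cubes -/

theorem hypercube_adj_iff {ι : Type u} [DecidableEq ι] {A B : Finset ι} :
    (hypercube ι).Adj A B ↔ (symmDiff A B).card = 1 := by
  change (symmDiff (A : Set ι) (B : Set ι)).encard = 1 ↔ _
  rw [← Finset.coe_symmDiff, Set.encard_coe_eq_coe_finsetCard]
  norm_cast

theorem card_symmDiff_le_length {ι : Type u} [DecidableEq ι] {A B : Finset ι}
    (p : (hypercube ι).Walk A B) : (symmDiff A B).card ≤ p.length := by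
  induction p with
  | nil => simp
  | @cons A C B h q ih =>
    have h1 := hypercube_adj_iff.1 h
    have h2 := (Finset.card_le_card (symmDiff_triangle A C B)).trans (Finset.card_union_le _ _)
    rw [SimpleGraph.Walk.length_cons]
    omega

theorem exists_walk_length_eq_card {ι : Type u} [DecidableEq ι] (n : ℕ) {A B : Finset ι}
    (h : (symmDiff A B).card = n) : ∃ p : (hypercube ι).Walk A B, p.length = n := by
  induction n generalizing A with
  | zero =>
    obtain rfl : A = B := symmDiff_eq_bot.1 (Finset.card_eq_zero.1 h)
    exact ⟨.nil, rfl⟩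
  | succ n ih =>
    obtain ⟨i, hi⟩ := Finset.card_pos.1 (by omega : 0 < (symmDiff A B).card)
    have h1 : symmDiff (symmDiff A {i}) B = (symmDiff A B).erase i := by
      ext j
      by_cases hj : j = i
      · subst hj
        simp only [Finset.mem_symmDiff, Finset.mem_singleton, Finset.mem_erase] at *
        tauto
      · simp only [Finset.mem_symmDiff, Finset.mem_singleton, Finset.mem_erase] at *
        tauto
    obtain ⟨p, hp⟩ := ih (A := symmDiff A {i}) (by rw [h1, Finset.card_erase_of_mem hi]; omega)
    refine ⟨.cons (hypercube_adj_iff.2 ?_) p, by simp [hp]⟩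
    rw [symmDiff_symmDiff_cancel_left]
    simp

theorem hypercube_dist {ι : Type u} [DecidableEq ι] (A B : Finset ι) :
    (hypercube ι).dist A B = (symmDiff A B).card := by
  obtain ⟨p, hp⟩ := exists_walk_length_eq_card _ (rfl : (symmDiff A B).card = _)
  refine le_antisymm (hp ▸ SimpleGraph.dist_le p) ?_
  obtain ⟨q, hq⟩ := SimpleGraph.Reachable.exists_walk_length_eq_dist ⟨p⟩
  exact hq ▸ card_symmDiff_le_length q

theorem card_symmDiff_singleton {ι : Type*} [DecidableEq ι] (A : Finset ι) (i : ι) :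
    (i ∈ A → (symmDiff A {i}).card + 1 = A.card) ∧
      (i ∉ A → (symmDiff A {i}).card = A.card + 1) := by
  constructor
  · intro h
    have : symmDiff A {i} = A.erase i := by
      ext j
      by_cases hj : j = i <;> simp [Finset.mem_symmDiff, hj, h]
    rw [this, Finset.card_erase_add_one h]
  · intro h
    have : symmDiff A {i} = insert i A := by
      ext j
      by_cases hj : j = i <;> simp [Finset.mem_symmDiff, hj, h]
    rw [this, Finset.card_insert_of_notMem h]

/-- Each coordinate separates none or exactly two of the three pairs. -/
theorem card_symmDiff_add_card_symmDiff_add_card_symmDiff_le {ι : Type*} [DecidableEq ι]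
    {A B C T : Finset ι} (hA : A ⊆ T) (hB : B ⊆ T) (hC : C ⊆ T) :
    (symmDiff A B).card + (symmDiff A C).card + (symmDiff B C).card ≤ 2 * T.card := by
  have h : ∀ X Y : Finset ι, X.card + Y.card + (symmDiff X Y).card = 2 * (X ∪ Y).card := by
    intro X Y
    have h1 := Finset.card_union_add_card_inter X Y
    have h2 : symmDiff X Y = (X ∪ Y) \ (X ∩ Y) := by
      ext j; simp [Finset.mem_symmDiff]; tauto
    have h3 := Finset.card_sdiff_add_card_eq_card
      (Finset.inter_subset_left.trans Finset.subset_union_left : X ∩ Y ⊆ X ∪ Y)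
    rw [h2]; omega
  have h1 : symmDiff B C = symmDiff (symmDiff A B) (symmDiff A C) := by
    ext j; simp only [Finset.mem_symmDiff]; tauto
  rw [h1, h]
  refine Nat.mul_le_mul_left 2 (Finset.card_le_card fun j hj => ?_)
  simp only [Finset.mem_union, Finset.mem_symmDiff] at hj
  rcases hj with (hj | hj) | (hj | hj)
  exacts [hA hj.1, hB hj.1, hA hj.1, hC hj.1]

/-- The edge `ab` flips a single coordinate `i`, and the vertices nearer to `a` are those agreeing
with `a` at `i`. -/
theorem IsPartialCube.isConvex_nearer (h : IsPartialCube G) {a b : V} (hab : G.Adj a b) :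
    IsConvex G (nearer G a b) := by
  classical
  obtain ⟨hc, ι, f, hf⟩ := h
  replace hf : ∀ x y, G.dist x y = (symmDiff (f x) (f y)).card := fun x y => by
    rw [← hf, hypercube_dist]
  obtain ⟨i, hi⟩ := Finset.card_eq_one.1 ((hf a b).symm.trans (SimpleGraph.dist_eq_one_iff_adj.2 hab))
  have key : ∀ x, x ∈ nearer G a b ↔ (i ∈ f x ↔ i ∈ f a) := by
    intro x
    have h1 : symmDiff (f x) (f b) = symmDiff (symmDiff (f x) (f a)) {i} := by
      rw [← hi]; ext j; simp only [Finset.mem_symmDiff]; tauto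
    have h2 := card_symmDiff_singleton (symmDiff (f x) (f a)) i
    simp only [nearer, Set.mem_ofPred_eq, hf, h1]
    by_cases h3 : i ∈ symmDiff (f x) (f a)
    · have := h2.1 h3
      rw [Finset.mem_symmDiff] at h3
      constructor
      · intro; omega
      · intro; tauto
    · have := h2.2 h3
      rw [Finset.mem_symmDiff] at h3
      constructor
      · intro; tauto
      · intro; omega
  rw [isConvex_iff hc]
  intro x hx y hy z hz
  rw [key] at hx hy ⊢
  by_contra hne
  rw [hf, hf, hf] at hz
  have h1 : symmDiff (f x) (f y) ⊆ symmDiff (f x) (f z) ∪ symmDiff (f z) (f y) :=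
    symmDiff_triangle _ _ _
  have h2 := Finset.card_union_add_card_inter (symmDiff (f x) (f z)) (symmDiff (f z) (f y))
  have h3 := Finset.card_le_card h1
  -- A detour through `z` flips coordinate `i` twice, so it is not a geodesic.
  have h4 : i ∈ symmDiff (f x) (f z) ∩ symmDiff (f z) (f y) := by
    simp only [Finset.mem_inter, Finset.mem_symmDiff]; tauto
  have h5 := Finset.card_pos.2 ⟨i, h4⟩
  omega

/-! ### Metric embeddings of small vertex sets into finite cubes -/

/-- Every vertex set that splits `S` is crossed by an edge of `G` with both ends in `S`. -/
def IsLinked (G : SimpleGraph V) (S : Set V) : Prop :=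
  ∀ A : Set V, ∀ s ∈ S, ∀ t ∈ S, s ∈ A → t ∉ A → ∃ r ∈ S, ∃ r' ∈ S, G.Adj r r' ∧ r ∈ A ∧ r' ∉ A

/-- `lam` embeds the linked set `S` into the cube of dimension `N`, preserving the distances
of `G`. -/
structure IsCubeEmb (G : SimpleGraph V) (S : Set V) (lam : V → Finset ℕ) (N : ℕ) : Prop where
  linked : IsLinked G S
  subset_range : ∀ z ∈ S, lam z ⊆ Finset.range N
  dist_eq : ∀ y ∈ S, ∀ z ∈ S, G.dist y z = (symmDiff (lam y) (lam z)).card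

theorem IsLinked.insert_vertex {S : Set V} (hS : IsLinked G S) {s w : V} (hs : s ∈ S) (h : G.Adj s w) :
    IsLinked G (insert w S) := by
  intro A p hp q hq hpA hqA
  by_cases hA : ∃ x ∈ S, x ∈ A
  · obtain ⟨x, hx, hxA⟩ := hA
    by_cases hB : ∃ y ∈ S, y ∉ A
    · obtain ⟨y, hy, hyA⟩ := hB
      obtain ⟨r, hr, r', hr', h'⟩ := hS A x hx y hy hxA hyA
      exact ⟨r, Or.inr hr, r', Or.inr hr', h'⟩
    · push Not at hB
      have hw : w ∉ A := by
        rcases hq with rfl | hq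
        · exact hqA
        · exact absurd (hB q hq) hqA
      exact ⟨s, Or.inr hs, w, Or.inl rfl, h, hB s hs, hw⟩
  · push Not at hA
    have hw : w ∈ A := by
      rcases hp with rfl | hp
      · exact hpA
      · exact absurd hpA (hA p hp)
    exact ⟨w, Or.inl rfl, s, Or.inr hs, h.symm, hw, hA s hs⟩

theorem IsCubeEmb.perimeter_le {S : Set V} {lam : V → Finset ℕ} {N : ℕ} (h : IsCubeEmb G S lam N)
    {x y z : V} (hx : x ∈ S) (hy : y ∈ S) (hz : z ∈ S) :
    G.dist x y + G.dist x z + G.dist y z ≤ 2 * N := by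
  rw [h.dist_eq x hx y hy, h.dist_eq x hx z hz, h.dist_eq y hy z hz]
  simpa using card_symmDiff_add_card_symmDiff_add_card_symmDiff_le (h.subset_range x hx)
    (h.subset_range y hy) (h.subset_range z hz)

theorem isCubeEmb_singleton (b : V) : IsCubeEmb G {b} (fun _ => ∅) 0 where
  linked := by
    rintro A s rfl t rfl h1 h2
    exact absurd h1 h2
  subset_range := by simp
  dist_eq := by
    rintro y rfl z rfl
    simp

/-- The label of `w` is `lam s` with coordinate `i` flipped; `hd` says that the edge `sw` splits `S`
just as this coordinate does. The coordinate may be old (`M = N`) or new (`M = N + 1`). -/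
theorem IsCubeEmb.insert_vertex {S : Set V} {lam : V → Finset ℕ} {N M i : ℕ}
    (h : IsCubeEmb G S lam N) {s w : V} (hs : s ∈ S) (hw : w ∉ S) (hsw : G.Adj s w)
    (hNM : N ≤ M) (hi : i < M)
    (hd : ∀ z ∈ S, (i ∉ symmDiff (lam s) (lam z) → G.dist z w = G.dist z s + 1) ∧
      (i ∈ symmDiff (lam s) (lam z) → G.dist z s = G.dist z w + 1)) :
    ∃ lam', IsCubeEmb G (insert w S) lam' M := by
  classical
  refine ⟨Function.update lam w (symmDiff (lam s) {i}), h.linked.insert_vertex hs hsw, ?_, ?_⟩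
  · rintro z (rfl | hz)
    · rw [Function.update_self]
      intro j hj
      rw [Finset.mem_symmDiff, Finset.mem_singleton] at hj
      rw [Finset.mem_range]
      rcases hj with hj | hj
      · have := Finset.mem_range.1 (h.subset_range s hs hj.1)
        omega
      · omega
    · rw [Function.update_of_ne (by rintro rfl; exact hw hz)]
      exact (h.subset_range z hz).trans (Finset.range_subset_range.2 hNM)
  · have key : ∀ z ∈ S, G.dist z w = (symmDiff (symmDiff (lam s) {i}) (lam z)).card := by
      intro z hz
      have h1 : symmDiff (symmDiff (lam s) {i}) (lam z) = symmDiff (symmDiff (lam s) (lam z)) {i} := by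
        ext j; simp only [Finset.mem_symmDiff]; tauto
      have h2 := card_symmDiff_singleton (symmDiff (lam s) (lam z)) i
      have h3 := hd z hz
      have h4 := h.dist_eq s hs z hz
      rw [SimpleGraph.dist_comm] at h4
      rw [h1]
      by_cases h5 : i ∈ symmDiff (lam s) (lam z)
      · have := h2.1 h5; have := h3.2 h5; omega
      · have := h2.2 h5; have := h3.1 h5; omega
    have hne : ∀ z ∈ S, z ≠ w := by rintro z hz rfl; exact hw hz
    rintro y (rfl | hy) z (rfl | hz)
    · simp
    · rw [Function.update_self, Function.update_of_ne (hne z hz), SimpleGraph.dist_comm, key z hz]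
    · rw [Function.update_self, Function.update_of_ne (hne y hy), symmDiff_comm, key y hy]
    · rw [Function.update_of_ne (hne y hy), Function.update_of_ne (hne z hz), h.dist_eq y hy z hz]

/-- The sets `nearer G p q` are closed under geodesics of triangles of perimeter less than `P`. -/
def NearerClosedBelow (G : SimpleGraph V) (P : ℕ) : Prop :=
  ∀ p q s t w : V, G.Adj p q → s ∈ nearer G p q → t ∈ nearer G p q →
    G.dist p s + G.dist p t + G.dist s t < P → G.dist s w + G.dist w t = G.dist s t →
      w ∈ nearer G p q

/-- Linkedness yields an edge `rr'` in `S` from the side of `s` to the side of `w`, and its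
coordinate can be reused for `sw`: a vertex on which the two edges disagree would give a triangle of
perimeter at most `2 * N` contradicting `hP`. -/
theorem IsCubeEmb.insert_of_crossing (hc : G.Connected) (hb : G.IsBipartite) {P : ℕ}
    (hP : NearerClosedBelow G P) {S : Set V} {lam : V → Finset ℕ} {N : ℕ}
    (h : IsCubeEmb G S lam N) (hN : 2 * N < P) {s w t : V} (hs : s ∈ S) (hw : w ∉ S)
    (hsw : G.Adj s w) (ht : t ∈ S) (htw : t ∈ nearer G w s) :
    ∃ lam', IsCubeEmb G (insert w S) lam' N := by
  have hss : s ∈ nearer G s w := by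
    simp [nearer, SimpleGraph.dist_eq_one_iff_adj.2 hsw]
  rw [← compl_nearer hc hb hsw] at htw
  obtain ⟨r, hr, r', hr', hrr, hrA, hrA'⟩ := h.linked _ s hs t ht hss htw
  rw [← Set.mem_compl_iff, compl_nearer hc hb hsw] at hrA'
  simp only [nearer, Set.mem_ofPred_eq] at hrA hrA'
  obtain ⟨i, hi⟩ := Finset.card_eq_one.1
    ((h.dist_eq r hr r' hr').symm.trans (SimpleGraph.dist_eq_one_iff_adj.2 hrr))
  have hi' : i ∈ symmDiff (lam r) (lam r') := by simp [hi]
  have hiN : i < N := by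
    rw [Finset.mem_symmDiff] at hi'
    rcases hi' with hi' | hi'
    · exact Finset.mem_range.1 (h.subset_range r hr hi'.1)
    · exact Finset.mem_range.1 (h.subset_range r' hr' hi'.1)
  have side : ∀ z ∈ S, (i ∈ symmDiff (lam r) (lam z) → G.dist z r = G.dist z r' + 1) ∧
      (i ∉ symmDiff (lam r) (lam z) → G.dist z r' = G.dist z r + 1) := by
    intro z hz
    have h1 : symmDiff (lam r') (lam z) = symmDiff (symmDiff (lam r) (lam z)) {i} := by
      rw [← hi]; ext j; simp only [Finset.mem_symmDiff]; tauto
    have h2 := card_symmDiff_singleton (symmDiff (lam r) (lam z)) i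
    rw [← h1] at h2
    rw [SimpleGraph.dist_comm (u := z), SimpleGraph.dist_comm (u := z), h.dist_eq r hr z hz,
      h.dist_eq r' hr' z hz]
    exact ⟨fun h3 => (h2.1 h3).symm, h2.2⟩
  have e1 := dist_adj_cases hc hb hsw r
  have e2 := dist_adj_cases hc hb hsw r'
  have e3 := dist_adj_cases hc hb hrr s
  have e4 := dist_le_succ_of_adj hc hrr.symm w
  have e5 := dist_le_succ_of_adj hc hrr w
  have c1 := G.dist_comm (u := s) (v := r)
  have c2 := G.dist_comm (u := s) (v := r')
  have c3 := G.dist_comm (u := w) (v := r)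
  have c4 := G.dist_comm (u := w) (v := r')
  have f1 : G.dist r w = G.dist r s + 1 := by omega
  have f2 : G.dist r' s = G.dist r' w + 1 := by omega
  have f3 : G.dist s r' = G.dist s r + 1 := by omega
  clear e1 e2 e3 e4 e5
  have hsr : i ∉ symmDiff (lam r) (lam s) := by
    intro h3
    have := (side s hs).1 h3
    omega
  refine h.insert_vertex hs hw hsw le_rfl hiN fun z hz => ?_
  have e6 := dist_adj_cases hc hb hsw z
  have c5 := G.dist_comm (u := s) (v := z)
  have c6 := G.dist_comm (u := w) (v := z)
  have c7 := G.dist_comm (u := r) (v := z)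
  have c8 := G.dist_comm (u := r') (v := z)
  have c9 := G.dist_comm (u := r') (v := r)
  have hper := h.perimeter_le hs hr hz
  have hrr1 := SimpleGraph.dist_eq_one_iff_adj.2 hrr
  constructor
  · intro h3
    have h4 : i ∉ symmDiff (lam r) (lam z) := by
      simp only [Finset.mem_symmDiff] at *; tauto
    have h5 := (side z hz).2 h4
    by_contra h6
    have h8 : G.dist z s = G.dist z w + 1 := by omega
    -- `r` lies between `r'` and `z`. As `w` and `r'` are at the same distance as `s` and `r`, the
    -- triangle `w, r', z` has the perimeter of `s, r, z`.
    have h7 := hP w s r' z r hsw.symm hrA' (show G.dist z w < G.dist z s by rw [h8]; exact Nat.lt_succ_self _)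
      (by omega) (by omega)
    simp only [nearer, Set.mem_ofPred_eq] at h7
    omega
  · intro h3
    have h4 : i ∈ symmDiff (lam r) (lam z) := by
      simp only [Finset.mem_symmDiff] at *; tauto
    have h5 := (side z hz).1 h4
    by_contra h6
    have h8 : G.dist z w = G.dist z s + 1 := by omega
    have h7 := hP s w r z r' hsw hrA (show G.dist z s < G.dist z w by rw [h8]; exact Nat.lt_succ_self _)
      (by omega) (by omega)
    simp only [nearer, Set.mem_ofPred_eq] at h7
    omega

theorem IsCubeEmb.insert_of_forall (hc : G.Connected) (hb : G.IsBipartite)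
    {S : Set V} {lam : V → Finset ℕ} {N : ℕ}
    (h : IsCubeEmb G S lam N) {s w : V} (hs : s ∈ S) (hw : w ∉ S)
    (hsw : G.Adj s w) (hS : ∀ t ∈ S, t ∉ nearer G w s) :
    ∃ lam', IsCubeEmb G (insert w S) lam' (N + 1) := by
  refine h.insert_vertex hs hw hsw (Nat.le_succ N) (Nat.lt_succ_self N) fun z hz => ⟨fun _ => ?_, ?_⟩
  · have h1 := hS z hz
    have h2 := dist_adj_cases hc hb hsw z
    simp only [nearer, Set.mem_ofPred_eq] at h1
    omega
  · intro h1
    rw [Finset.mem_symmDiff] at h1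
    rcases h1 with h1 | h1
    · exact absurd (h.subset_range s hs h1.1) Finset.notMem_range_self
    · exact absurd (h.subset_range z hz h1.1) Finset.notMem_range_self

/-- A geodesic starting in a cube-embedded set can be added to it. -/
theorem IsCubeEmb.exists_extend_geodesic (hc : G.Connected) (hb : G.IsBipartite) {P : ℕ}
    (hP : NearerClosedBelow G P) {b p q : V}
    (hper : G.dist b p + G.dist b q + G.dist p q < P) (m : ℕ) {c : V} (hm : G.dist c q = m)
    (hcq : G.dist p c + G.dist c q = G.dist p q) {S : Set V} {lam : V → Finset ℕ} {N : ℕ}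
    (h : IsCubeEmb G S lam N) (hbS : b ∈ S) (hpS : p ∈ S) (hcS : c ∈ S)
    (hN : 2 * N = G.dist b p + G.dist b c + G.dist p c) :
    ∃ S' lam' N', IsCubeEmb G S' lam' N' ∧ b ∈ S' ∧ p ∈ S' ∧ q ∈ S' ∧
      2 * N' = G.dist b p + G.dist b q + G.dist p q := by
  induction m generalizing c S lam N with
  | zero =>
    obtain rfl := hc.dist_eq_zero_iff.1 hm
    exact ⟨S, lam, N, h, hbS, hpS, hcS, hN⟩
  | succ m ih =>
    obtain ⟨w, hcw, hwq⟩ := exists_adj_dist_add_one hc (s := c) (z := q)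
      (by rintro rfl; simp at hm)
    have t1 := hc.dist_triangle (u := p) (v := w) (w := q)
    have t2 := dist_le_succ_of_adj hc hcw p
    have t3 := dist_adj_cases hc hb hcw b
    have t4 := hc.dist_triangle (u := b) (v := q) (w := c)
    have c1 := G.dist_comm (u := q) (v := c)
    -- Without a new coordinate, the perimeter of `b, p, w` is at most `2 * N`. This forces `w` to
    -- be nearer to `b` than `c` is, so the perimeter stays the same.
    by_cases hwS : w ∈ S
    · have := h.perimeter_le hbS hpS hwS
      exact ih (by omega) (by omega) h hbS hpS hwS (by omega)
    by_cases hcr : ∃ t ∈ S, t ∈ nearer G w c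
    · obtain ⟨t, ht, htw⟩ := hcr
      obtain ⟨lam', h'⟩ := h.insert_of_crossing hc hb hP (by omega) hcS hwS hcw ht htw
      have := h'.perimeter_le (Or.inr hbS) (Or.inr hpS) (Or.inl rfl)
      exact ih (by omega) (by omega) h' (Or.inr hbS) (Or.inr hpS) (Or.inl rfl) (by omega)
    · push Not at hcr
      obtain ⟨lam', h'⟩ := h.insert_of_forall hc hb hcS hwS hcw hcr
      -- Here `w` is farther from `b` than `c` is: the perimeter grows by 2, matching the new
      -- coordinate.
      have := hcr b hbS
      simp only [nearer, Set.mem_ofPred_eq] at this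
      exact ih (by omega) (by omega) h' (Or.inr hbS) (Or.inr hpS) (Or.inl rfl) (by omega)

/-- Follow a geodesic from `s` to `z` until it leaves `S`; each of its steps also approaches `t`. -/
theorem exists_adj_notMem_of_geodesic (hc : G.Connected) {S : Set V} {z t : V} (hz : z ∉ S)
    (n : ℕ) {s : V} (hs : s ∈ S) (hn : G.dist s z = n)
    (hst : G.dist s z + G.dist z t = G.dist s t) :
    ∃ r ∈ S, ∃ w, w ∉ S ∧ G.Adj r w ∧ G.dist t w < G.dist t r := by
  induction n generalizing s with
  | zero =>
    obtain rfl := hc.dist_eq_zero_iff.1 hn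
    exact absurd hs hz
  | succ n ih =>
    obtain ⟨w, hsw, hwz⟩ := exists_adj_dist_add_one hc (s := s) (z := z)
      (by rintro rfl; simp at hn)
    have t1 := hc.dist_triangle (u := w) (v := z) (w := t)
    have t2 := dist_le_succ_of_adj hc hsw.symm t
    have c1 := G.dist_comm (u := t) (v := s)
    have c2 := G.dist_comm (u := t) (v := w)
    by_cases hw : w ∈ S
    · exact ih hw (by omega) (by omega)
    · exact ⟨s, hs, w, hw, hsw, by omega⟩

theorem IsCubeEmb.ncard_le {S : Set V} {lam : V → Finset ℕ} {N : ℕ} (hc : G.Connected)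
    (h : IsCubeEmb G S lam N) : S.Finite ∧ S.ncard ≤ 2 ^ N := by
  have hinj : Set.InjOn lam S := by
    intro x hx y hy hxy
    rw [← hc.dist_eq_zero_iff, h.dist_eq x hx y hy, hxy]
    simp
  have himg : lam '' S ⊆ ((Finset.range N).powerset : Set (Finset ℕ)) := by
    rintro _ ⟨x, hx, rfl⟩
    exact Finset.mem_coe.2 (Finset.mem_powerset.2 (h.subset_range x hx))
  refine ⟨Set.Finite.of_finite_image ((Finset.finite_toSet _).subset himg) hinj, ?_⟩
  rw [← hinj.ncard_image]
  refine (Set.ncard_le_ncard himg (Finset.finite_toSet _)).trans ?_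
  rw [Set.ncard_coe_finset, Finset.card_powerset, Finset.card_range]

/-- A set embedded in a cube whose dimension is less than `P / 2` has a convex superset embedded in
the same cube. -/
theorem IsCubeEmb.exists_isConvex (hc : G.Connected) (hb : G.IsBipartite) {P : ℕ}
    (hP : NearerClosedBelow G P) {N : ℕ} (hN : 2 * N < P) (k : ℕ) {S : Set V}
    {lam : V → Finset ℕ} (h : IsCubeEmb G S lam N) (hk : 2 ^ N - S.ncard = k) :
    ∃ S' lam', IsCubeEmb G S' lam' N ∧ S ⊆ S' ∧ IsConvex G S' := by
  induction k using Nat.strong_induction_on generalizing S lam with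
  | _ k ih =>
    by_cases hS : IsConvex G S
    · exact ⟨S, lam, h, subset_rfl, hS⟩
    rw [isConvex_iff hc] at hS
    push Not at hS
    obtain ⟨s, hs, t, ht, z, hz, hzS⟩ := hS
    obtain ⟨r, hr, w, hw, hrw, hd⟩ := exists_adj_notMem_of_geodesic hc hzS _ hs rfl hz
    -- Since `t` is nearer to `w` than to `r`, the dimension stays `N`; the bound `2 ^ N` on the
    -- size of `S` makes the process stop.
    obtain ⟨lam', h'⟩ := h.insert_of_crossing hc hb hP hN hr hw hrw ht hd
    have h1 := (h'.ncard_le hc).2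
    rw [Set.ncard_insert_of_notMem hw (h.ncard_le hc).1] at h1
    obtain ⟨S', lam'', h2, h3, h4⟩ := ih (2 ^ N - (insert w S).ncard)
      (by rw [Set.ncard_insert_of_notMem hw (h.ncard_le hc).1]; omega) h' rfl
    exact ⟨S', lam'', h2, (Set.subset_insert w S).trans h3, h4⟩

/-! ### Copoints -/

theorem exists_isCopointAt_of_notMem {C : Set V} {x : V} (hC : IsConvex G C) (hx : x ∉ C) :
    ∃ K, C ⊆ K ∧ IsCopointAt G K x := by
  obtain ⟨K, hCK, hK⟩ := zorn_subset_nonempty {C : Set V | IsConvex G C ∧ x ∉ C}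
    (fun c hc hchain _ => by
      refine ⟨⋃₀ c, ⟨?_, ?_⟩, fun s hs => Set.subset_sUnion_of_mem hs⟩
      · rintro y ⟨s, hs, hy⟩ z ⟨t, ht, hz⟩
        rcases hchain.total hs ht with h | h
        · exact ((hc ht).1 y (h hy) z hz).trans (Set.subset_sUnion_of_mem ht)
        · exact ((hc hs).1 y hy z (h hz)).trans (Set.subset_sUnion_of_mem hs)
      · rintro ⟨s, hs, hxs⟩
        exact (hc hs).2 hxs) C ⟨hC, hx⟩
  exact ⟨K, hCK, hK⟩

/-- The convex hull of a set of vertices. -/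
def hull (G : SimpleGraph V) (S : Set V) : Set V := {x | ∀ C, IsConvex G C → S ⊆ C → x ∈ C}

theorem isConvex_hull (S : Set V) : IsConvex G (hull G S) :=
  fun x hx y hy _ hz C hC hS => hC x (hx C hC hS) y (hy C hC hS) hz

theorem subset_hull (S : Set V) : S ⊆ hull G S := fun _ hx _ _ hS => hS hx

theorem hull_subset {S C : Set V} (hC : IsConvex G C) (hS : S ⊆ C) : hull G S ⊆ C :=
  fun _ hx => hx C hC hS

theorem IsCopointAt.subset_of_ssubset {K C : Set V} {x : V} (hK : IsCopointAt G K x)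
    (hC : IsConvex G C) (h : K ⊂ C) : hull G (insert x K) ⊆ C := by
  refine hull_subset hC (Set.insert_subset ?_ h.subset)
  by_contra hx
  exact h.not_subset (hK.2 ⟨hC, hx⟩ h.subset)

/-- The hull is the least convex set properly containing `K`, so `K` is a copoint at exactly the
vertices that this set adds. -/
theorem IsCopointAt.att_eq {K : Set V} {x : V} (hK : IsCopointAt G K x) :
    Att G K = hull G (insert x K) \ K := by
  have hxK : K ⊂ hull G (insert x K) := by
    refine ⟨(Set.subset_insert x K).trans (subset_hull _), fun h => ?_⟩
    exact hK.1.2 (h (subset_hull _ (Set.mem_insert x K)))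
  ext y
  constructor
  · intro hy
    exact ⟨IsCopointAt.subset_of_ssubset hy (isConvex_hull _) hxK
      (subset_hull _ (Set.mem_insert y K)), hy.1.2⟩
  · rintro ⟨hy, hyK⟩
    refine ⟨⟨hK.1.1, hyK⟩, fun C hC hKC => ?_⟩
    by_contra h
    exact hC.2 (hK.subset_of_ssubset hC.1 ⟨hKC, h⟩ hy)

/-! ### Att-convex bipartite graphs are partial cubes -/

theorem IsAttConvex.isConvex_nearer (hc : G.Connected) (hb : G.IsBipartite) (h : IsAttConvex G)
    {a b : V} (hab : G.Adj a b) : IsConvex G (nearer G a b) := by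
  classical
  by_contra hcon
  let Fails : ℕ → ℕ → Prop := fun P n => ∃ a b u v w : V, G.Adj a b ∧ u ∈ nearer G a b ∧
    v ∈ nearer G a b ∧ w ∉ nearer G a b ∧ G.dist u w + G.dist w v = G.dist u v ∧
    G.dist a u + G.dist a v + G.dist u v = P ∧ G.dist u v = n
  have hex : ∃ P, ∃ n, Fails P n := by
    rw [isConvex_iff hc] at hcon
    push Not at hcon
    obtain ⟨u, hu, v, hv, w, huv, hw⟩ := hcon
    exact ⟨_, _, a, b, u, v, w, hab, hu, hv, hw, huv, rfl, rfl⟩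
  obtain ⟨P, hex', hmin⟩ : ∃ P, (∃ n, Fails P n) ∧ ∀ P' < P, ¬ ∃ n, Fails P' n :=
    ⟨_, Nat.find_spec hex, fun _ => Nat.find_min hex⟩
  obtain ⟨n, hn, hmin'⟩ : ∃ n, Fails P n ∧ ∀ n' < n, ¬ Fails P n' :=
    ⟨_, Nat.find_spec hex', fun _ => Nat.find_min hex'⟩
  clear hab hcon hex hex' a b
  have hP : NearerClosedBelow G P := by
    intro p q s t w hpq hs ht hlt hw
    by_contra hcon
    exact hmin _ hlt ⟨_, p, q, s, t, w, hpq, hs, ht, hcon, hw, rfl, rfl⟩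
  obtain ⟨a, b, u, v, w, hab, hu, hv, hw, huv, hPeq, hneq⟩ := hn
  obtain ⟨u', huu, huw⟩ := exists_adj_dist_add_one hc (s := u) (z := w)
    (by rintro rfl; exact hw hu)
  obtain ⟨v', hvv, hvw⟩ := exists_adj_dist_add_one hc (s := v) (z := w)
    (by rintro rfl; exact hw hv)
  have c1 := G.dist_comm (u := v) (v := w)
  have c2 := G.dist_comm (u := v') (v := w)
  have t1 := hc.dist_triangle (u := u') (v := w) (w := v)
  have t2 := dist_le_succ_of_adj hc huu.symm v
  have t3 := dist_le_succ_of_adj hc hvv.symm u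
  have c3 := G.dist_comm (u := u) (v := v)
  have c4 := G.dist_comm (u := u') (v := v)
  have t4 := hc.dist_triangle (u := u) (v := w) (w := v')
  have t5 := hc.dist_triangle (u := u') (v := w) (w := v')
  have t6 := dist_le_succ_of_adj hc hvv.symm u'
  have t7 := dist_le_succ_of_adj hc huu a
  have t8 := dist_le_succ_of_adj hc hvv a
  -- Replacing `u` by `u'` does not raise the perimeter and shortens the base, against minimality.
  have hu' : u' ∉ nearer G a b := by
    intro hu'
    have e : G.dist a u' + G.dist a v + G.dist u' v = P := by
      by_contra hne
      exact hmin _ (by omega) ⟨_, a, b, u', v, w, hab, hu', hv, hw, by omega, rfl, rfl⟩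
    exact hmin' _ (by omega) ⟨a, b, u', v, w, hab, hu', hv, hw, by omega, e, rfl⟩
  have hv' : v' ∉ nearer G a b := by
    intro hv'
    have e : G.dist a u + G.dist a v' + G.dist u v' = P := by
      by_contra hne
      exact hmin _ (by omega) ⟨_, a, b, u, v', w, hab, hu, hv', hw, by omega, rfl, rfl⟩
    exact hmin' _ (by omega) ⟨a, b, u, v', w, hab, hu, hv', hw, by omega, e, rfl⟩
  have step : ∀ x y : V, G.Adj x y → x ∈ nearer G a b → y ∉ nearer G a b →
      G.dist b y = G.dist a x ∧ G.dist a y = G.dist a x + 1 ∧ G.dist b x = G.dist a x + 1 := by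
    intro x y hxy hx hy
    simp only [nearer, Set.mem_ofPred_eq] at hx hy
    have s1 := dist_adj_cases hc hb hab x
    have s2 := dist_adj_cases hc hb hab y
    have s3 := dist_le_succ_of_adj hc hxy a
    have s4 := dist_le_succ_of_adj hc hxy.symm b
    have d1 := G.dist_comm (u := x) (v := a)
    have d2 := G.dist_comm (u := x) (v := b)
    have d3 := G.dist_comm (u := y) (v := a)
    have d4 := G.dist_comm (u := y) (v := b)
    omega
  have su := step u u' huu hu hu'
  have sv := step v v' hvv hv hv'
  have hbb : G.dist b b = 0 := SimpleGraph.dist_self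
  -- The sides at `b` equal those at `a` in the old triangle, and the base is shorter by at least 2.
  have hper : G.dist b u' + G.dist b v' + G.dist u' v' < P := by omega
  have t9 := hc.dist_triangle (u := b) (v := v') (w := u')
  have c5 := G.dist_comm (u := u') (v := v')
  -- A geodesic from `b` to `u'` comes first, as a degenerate triangle grown from the single point
  -- `b`.
  obtain ⟨S₁, lam₁, N₁, h₁, hb₁, -, hu₁, hN₁⟩ :=
    (isCubeEmb_singleton (G := G) b).exists_extend_geodesic hc hb hP (b := b) (p := b) (q := u')
      (by omega) _ rfl (by omega) rfl rfl rfl (by omega)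
  have huu' : G.dist u' u' = 0 := SimpleGraph.dist_self
  obtain ⟨S₂, lam₂, N, h₂, hb₂, hu₂, hv₂, hN⟩ :=
    h₁.exists_extend_geodesic hc hb hP hper _ rfl (by omega) hb₁ hu₁ hu₁ (by omega)
  obtain ⟨S, lam, hS, hsub, hconv⟩ := h₂.exists_isConvex hc hb hP (by omega) _ rfl
  -- Otherwise convexity puts `u` and `v` in `S`, where no triangle has perimeter `P > 2 * N`.
  have haS : a ∉ S := by
    intro haS
    have k1 := SimpleGraph.dist_eq_one_iff_adj.2 huu
    have k2 := SimpleGraph.dist_eq_one_iff_adj.2 hvv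
    rw [isConvex_iff hc] at hconv
    have := hS.perimeter_le haS (hconv a haS u' (hsub hu₂) u (by omega))
      (hconv a haS v' (hsub hv₂) v (by omega))
    omega
  obtain ⟨K, hSK, hK⟩ := exists_isCopointAt_of_notMem hconv haS
  have k0 := SimpleGraph.dist_eq_one_iff_adj.2 hab.symm
  -- `x` lies between `a` and `y`, hence in the hull; and `a` lies between `b` and `x`, so `x ∈ K`
  -- would force `a ∈ K`.
  have mem_att : ∀ x y : V, G.Adj x y → x ∈ nearer G a b → y ∉ nearer G a b → y ∈ S →
      x ∈ Att G K := by
    intro x y hxy hx hy hyS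
    have s := step x y hxy hx hy
    have k := SimpleGraph.dist_eq_one_iff_adj.2 hxy
    rw [hK.att_eq]
    constructor
    · refine (isConvex_iff hc).1 (isConvex_hull _) a (subset_hull _ (Set.mem_insert _ _)) y
        (subset_hull _ (Set.mem_insert_of_mem _ (hSK hyS))) x (by omega)
    · intro hxK
      exact hK.1.2 ((isConvex_iff hc).1 hK.1.1 b (hSK (hsub hb₂)) x hxK a (by omega))
  have hmem := (isConvex_iff hc).1 (h K ⟨a, hK⟩) u (mem_att u u' huu hu hu' (hsub hu₂)) v
    (mem_att v v' hvv hv hv' (hsub hv₂)) u'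
    (by have := SimpleGraph.dist_eq_one_iff_adj.2 huu; omega)
  exact hmem.1.2 (hSK (hsub hu₂))

/-- Djoković's characterization of partial cubes. -/
theorem isPartialCube_of_isConvex_nearer (hc : G.Connected) (hb : G.IsBipartite)
    (h : ∀ a b : V, G.Adj a b → IsConvex G (nearer G a b)) : IsPartialCube G := by
  classical
  obtain ⟨v₀⟩ := hc.nonempty
  -- Indexing by sets merges the edges that define the same cut. Keeping only sets that miss `v₀`
  -- makes `g v₀` empty, which yields finiteness of every `g x`.
  let ι : Type u := {W : Set V // (∃ a b, G.Adj a b ∧ W = nearer G a b) ∧ v₀ ∉ W}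
  let g : V → Set ι := fun x => {W | x ∈ W.1}
  have eq_nearer : ∀ a b c d : V, G.Adj a b → G.Adj c d → c ∈ nearer G a b → d ∉ nearer G a b →
      nearer G a b = nearer G c d := by
    -- If `x` were outside `nearer G c d`, then `d` would lie between `x` and `c`, hence in `nearer
    -- G a b`.
    have key : ∀ a b c d : V, G.Adj a b → G.Adj c d → c ∈ nearer G a b → d ∉ nearer G a b →
        nearer G a b ⊆ nearer G c d := by
      intro a b c d hab hcd hca hda x hx
      by_contra hxc
      apply hda
      refine (isConvex_iff hc).1 (h a b hab) x hx c hca d ?_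
      have := dist_adj_cases hc hb hcd x
      have := SimpleGraph.dist_eq_one_iff_adj.2 hcd.symm
      simp only [nearer, Set.mem_ofPred_eq] at hxc
      omega
    intro a b c d hab hcd hca hda
    refine (key a b c d hab hcd hca hda).antisymm ?_
    have h1 := key b a d c hab.symm hcd.symm (by rwa [← compl_nearer hc hb hab])
      (by rw [← compl_nearer hc hb hab]; simpa using hca)
    rw [← compl_nearer hc hb hab, ← compl_nearer hc hb hcd] at h1
    exact Set.compl_subset_compl.1 h1
  have edge : ∀ c d : V, G.Adj c d → ∃ W : ι, symmDiff (g c) (g d) = {W} ∧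
      (W.1 = nearer G c d ∨ W.1 = nearer G d c) := by
    intro c d hcd
    have hcc : c ∈ nearer G c d := by
      simp [nearer, SimpleGraph.dist_eq_one_iff_adj.2 hcd]
    have hdd : d ∈ nearer G d c := by
      simp [nearer, SimpleGraph.dist_eq_one_iff_adj.2 hcd.symm]
    have hcc' : c ∉ nearer G d c := by
      rw [← compl_nearer hc hb hcd]; simpa using hcc
    have hdd' : d ∉ nearer G c d := by
      rw [← compl_nearer hc hb hcd.symm]; simpa using hdd
    have cross : ∀ W : ι, W ∈ symmDiff (g c) (g d) → W.1 = nearer G c d ∨ W.1 = nearer G d c := by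
      rintro ⟨W, ⟨a, b, hab, rfl⟩, hv⟩ hW
      rcases hW with ⟨hW1, hW2⟩ | ⟨hW1, hW2⟩
      · exact Or.inl (eq_nearer a b c d hab hcd hW1 hW2)
      · exact Or.inr (eq_nearer a b d c hab hcd.symm hW1 hW2)
    by_cases hv : v₀ ∈ nearer G c d
    · have hv' : v₀ ∉ nearer G d c := by
        rw [← compl_nearer hc hb hcd]; simpa using hv
      refine ⟨⟨nearer G d c, ⟨d, c, hcd.symm, rfl⟩, hv'⟩, ?_, Or.inr rfl⟩
      refine Set.Subset.antisymm (fun W hW => ?_) (Set.singleton_subset_iff.2 (Or.inr ⟨hdd, hcc'⟩))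
      rcases cross W hW with h1 | h1
      · exact absurd (h1 ▸ hv) W.2.2
      · exact Subtype.ext h1
    · refine ⟨⟨nearer G c d, ⟨c, d, hcd, rfl⟩, hv⟩, ?_, Or.inl rfl⟩
      refine Set.Subset.antisymm (fun W hW => ?_) (Set.singleton_subset_iff.2 (Or.inl ⟨hcc, hdd'⟩))
      rcases cross W hW with h1 | h1
      · exact Subtype.ext h1
      · exact absurd (h1 ▸ (compl_nearer hc hb hcd).subset hv) W.2.2
  have hg : ∀ (n : ℕ) (x y : V), G.dist x y = n → (symmDiff (g x) (g y)).encard = n := by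
    intro n
    induction n with
    | zero =>
      intro x y hxy
      obtain rfl := hc.dist_eq_zero_iff.1 hxy
      simp
    | succ n ih =>
      intro x y hxy
      obtain ⟨z, hyz, hzx⟩ := exists_adj_dist_add_one hc (s := y) (z := x)
        (by rintro rfl; simp at hxy)
      have c1 := G.dist_comm (u := x) (v := y)
      have c2 := G.dist_comm (u := z) (v := x)
      obtain ⟨W, hW, hW'⟩ := edge y z hyz
      -- `x` and `z` are on the same side of the edge `yz`, so its coordinate has not been flipped
      -- before.
      have h1 : W ∉ symmDiff (g x) (g z) := by
        have hx : x ∈ nearer G z y := show G.dist x z < G.dist x y by omega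
        have hz : z ∈ nearer G z y := by
          simp [nearer, SimpleGraph.dist_eq_one_iff_adj.2 hyz.symm]
        have hx' : x ∉ nearer G y z := by
          rw [← compl_nearer hc hb hyz.symm]; simpa using hx
        have hz' : z ∉ nearer G y z := by
          rw [← compl_nearer hc hb hyz.symm]; simpa using hz
        rintro (⟨h1, h2⟩ | ⟨h1, h2⟩) <;> rcases hW' with h3 | h3
        · exact hx' (h3 ▸ h1)
        · exact h2 (show z ∈ W.1 from h3 ▸ hz)
        · exact hz' (h3 ▸ h1)
        · exact h2 (show x ∈ W.1 from h3 ▸ hx)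
      have h2 : symmDiff (g x) (g y) = insert W (symmDiff (g x) (g z)) := by
        have h3 : symmDiff (g x) (g y) = symmDiff (symmDiff (g x) (g z)) {W} := by
          rw [← hW, symmDiff_comm (g y), symmDiff_assoc, symmDiff_symmDiff_cancel_left]
        rw [h3]
        ext U
        by_cases hU : U = W
        · subst hU; simp [Set.mem_symmDiff, h1]
        · simp [Set.mem_symmDiff, hU]
      rw [h2, Set.encard_insert_of_notMem h1, ih x z (by omega)]
      norm_cast
  have hfin : ∀ x, (g x).Finite := by
    intro x
    have h0 : g v₀ = ∅ := Set.eq_empty_of_forall_notMem fun W hW => W.2.2 hW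
    have := hg _ v₀ x rfl
    rw [h0] at this
    refine Set.finite_of_encard_eq_coe (k := G.dist v₀ x) ?_
    simpa [← Set.bot_eq_empty] using this
  let f : V → Finset ι := fun x => (hfin x).toFinset
  have hf : ∀ x y, (symmDiff (f x) (f y)).card = G.dist x y := by
    intro x y
    have := hg _ x y rfl
    rw [← (hfin x).coe_toFinset, ← (hfin y).coe_toFinset, ← Finset.coe_symmDiff,
      Set.encard_coe_eq_coe_finsetCard] at this
    exact_mod_cast this
  refine ⟨hc, ι, ⟨⟨f, fun x y hxy => ?_⟩, fun {x y} => ?_⟩, fun x y => ?_⟩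
  · rw [← hc.dist_eq_zero_iff, ← hf, hxy]
    simp
  · change (hypercube ι).Adj (f x) (f y) ↔ _
    rw [hypercube_adj_iff, hf, SimpleGraph.dist_eq_one_iff_adj]
  · change (hypercube ι).dist (f x) (f y) = _
    rw [hypercube_dist, hf]

/-! ### Convex subgraphs -/

theorem exists_coe_walk {F : G.Subgraph} (hF : F.IsInduced) {x y : V} (p : G.Walk x y)
    (h : ∀ z ∈ p.support, z ∈ F.verts) (hx : x ∈ F.verts) (hy : y ∈ F.verts) :
    ∃ q : F.coe.Walk ⟨x, hx⟩ ⟨y, hy⟩, q.length = p.length ∧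
      q.support.map Subtype.val = p.support := by
  induction p with
  | nil => exact ⟨.nil, rfl, rfl⟩
  | @cons x w y hxw p ih =>
    rw [SimpleGraph.Walk.support_cons] at h
    have hw : w ∈ F.verts := h w (List.mem_cons_of_mem _ p.start_mem_support)
    obtain ⟨q, hq, hq'⟩ := ih (fun z hz => h z (List.mem_cons_of_mem _ hz)) hw hy
    refine ⟨.cons ((SimpleGraph.Subgraph.coe_adj F ⟨x, hx⟩ ⟨w, hw⟩).mpr (hF hx hw hxw)) q, ?_, ?_⟩
    · simp [hq]
    · simp [hq']

theorem IsConvexSubgraph.dist_coe (hc : G.Connected) {F : G.Subgraph} (hF : IsConvexSubgraph G F)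
    (x y : F.verts) : F.coe.dist x y = G.dist x y := by
  obtain ⟨p, hp⟩ := hc.exists_walk_length_eq_dist (x : V) y
  obtain ⟨q, hq, -⟩ := exists_coe_walk hF.1 p (fun z hz => hF.2 x x.2 y y.2 ⟨p, hp, hz⟩) x.2 y.2
  refine le_antisymm (by rw [← hp, ← hq]; exact SimpleGraph.dist_le q) ?_
  obtain ⟨r, hr⟩ := SimpleGraph.Reachable.exists_walk_length_eq_dist ⟨q⟩
  rw [← hr, ← SimpleGraph.Walk.length_map F.hom r]
  exact SimpleGraph.dist_le (r.map F.hom)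

theorem IsConvexSubgraph.mem_interval_coe_iff (hc : G.Connected) {F : G.Subgraph}
    (hF : IsConvexSubgraph G F) {x y z : F.verts} :
    z ∈ interval F.coe x y ↔ (z : V) ∈ interval G x y := by
  constructor
  · rintro ⟨p, hp, hz⟩
    refine ⟨p.map F.hom, ?_, ?_⟩
    · exact (SimpleGraph.Walk.length_map F.hom p).trans (hp.trans (hF.dist_coe hc x y))
    · exact (SimpleGraph.Walk.support_map F.hom p).symm ▸ List.mem_map_of_mem (f := F.hom) hz
  · rintro ⟨p, hp, hz⟩
    obtain ⟨q, hq, hq'⟩ := exists_coe_walk hF.1 p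
      (fun z hz => hF.2 x x.2 y y.2 ⟨p, hp, hz⟩) x.2 y.2
    refine ⟨q, by rw [hF.dist_coe hc, ← hp, hq], ?_⟩
    rw [← hq', List.mem_map] at hz
    obtain ⟨w, hw, hwz⟩ := hz
    rwa [← Subtype.ext hwz]

theorem IsConvexSubgraph.isConvex_coe_iff (hc : G.Connected) {F : G.Subgraph}
    (hF : IsConvexSubgraph G F) {K : Set F.verts} :
    IsConvex F.coe K ↔ IsConvex G (Subtype.val '' K) := by
  constructor
  · rintro h _ ⟨x, hx, rfl⟩ _ ⟨y, hy, rfl⟩ z hz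
    exact ⟨⟨z, hF.2 x x.2 y y.2 hz⟩, h x hx y hy ((hF.mem_interval_coe_iff hc).2 hz), rfl⟩
  · intro h x hx y hy z hz
    obtain ⟨w, hw, hwz⟩ := h x ⟨x, hx, rfl⟩ y ⟨y, hy, rfl⟩ ((hF.mem_interval_coe_iff hc).1 hz)
    rwa [← Subtype.ext hwz]

theorem IsConvex.preimage_coe (hc : G.Connected) {F : G.Subgraph}
    (hF : IsConvexSubgraph G F) {C : Set V} (hC : IsConvex G C) :
    IsConvex F.coe (Subtype.val ⁻¹' C : Set F.verts) :=
  fun x hx y hy _ hz => hC x hx y hy ((hF.mem_interval_coe_iff hc).1 hz)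

theorem IsPartialCube.isHalfSpace_of_isMaximalProperConvex (hb : G.IsBipartite)
    (h : IsPartialCube G) {F : G.Subgraph} (hF : IsConvexSubgraph G F) {K : Set F.verts}
    (hK : IsMaximalProperConvex F.coe K) : IsHalfSpace F.coe K := by
  classical
  have hc := h.1
  refine ⟨hK.1.1, ?_⟩
  rcases K.eq_empty_or_nonempty with rfl | ⟨y₀, hy₀⟩
  · rw [Set.compl_empty]
    exact fun _ _ _ _ => Set.subset_univ _
  obtain ⟨x, hx⟩ := (Set.ne_univ_iff_exists_notMem K).1 hK.1.2
  obtain ⟨n, ⟨y, hy, hyn⟩, hmin⟩ : ∃ n, (∃ y ∈ K, G.dist (y : V) x = n) ∧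
      ∀ m < n, ¬ ∃ y ∈ K, G.dist (y : V) x = m :=
    have hex : ∃ n, ∃ y ∈ K, G.dist (y : V) x = n := ⟨_, y₀, hy₀, rfl⟩
    ⟨_, Nat.find_spec hex, fun _ => Nat.find_min hex⟩
  obtain ⟨w, hyw, hwx⟩ := exists_adj_dist_add_one hc (s := (y : V)) (z := x)
    (fun hyx => hx (Subtype.ext hyx ▸ hy))
  have hyw1 := SimpleGraph.dist_eq_one_iff_adj.2 hyw
  have hwF : w ∈ F.verts := (isConvex_iff hc).1 hF.2 y y.2 x x.2 w (by omega)
  have hwK : ∀ z ∈ K, (z : V) ≠ w := by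
    rintro z hz rfl
    exact hmin _ (by omega) ⟨z, hz, rfl⟩
  -- A vertex of `K` nearer to `w` than to `y` would have `w` between it and `y`, hence `w` in `K`.
  have hsub : K ⊆ Subtype.val ⁻¹' nearer G y w := by
    intro k hk
    by_contra hkn
    have hd := dist_adj_cases hc hb hyw k
    simp only [nearer, Set.mem_preimage, Set.mem_ofPred_eq] at hkn
    obtain ⟨z, hz, hzw⟩ := (isConvex_iff hc).1 ((hF.isConvex_coe_iff hc).1 hK.1.1)
      k ⟨k, hk, rfl⟩ y ⟨y, hy, rfl⟩ w
      (by have := G.dist_comm (u := (y : V)) (v := w); omega)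
    exact hwK z hz hzw
  have hne : (Subtype.val ⁻¹' nearer G y w : Set F.verts) ≠ Set.univ := by
    intro heq
    have : (⟨w, hwF⟩ : F.verts) ∈ (Subtype.val ⁻¹' nearer G y w : Set F.verts) := heq ▸ trivial
    simp [nearer] at this
  have hKeq : K = Subtype.val ⁻¹' nearer G y w :=
    hsub.antisymm (hK.2 ⟨(h.isConvex_nearer hyw).preimage_coe hc hF, hne⟩ hsub)
  rw [hKeq, ← Set.preimage_compl, compl_nearer hc hb hyw]
  exact (h.isConvex_nearer hyw.symm).preimage_coe hc hF

/-- In the subgraph induced on the hull of `insert x K`, the copoint `K` is maximal proper convex,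
and its complement there is `Att G K`. -/
theorem isAttConvex_of_isHalfSpace (hc : G.Connected)
    (h : ∀ F : G.Subgraph, IsConvexSubgraph G F →
      ∀ K : Set F.verts, IsMaximalProperConvex F.coe K → IsHalfSpace F.coe K) :
    IsAttConvex G := by
  rintro K ⟨x, hK⟩
  let F : G.Subgraph := (⊤ : G.Subgraph).induce (hull G (insert x K))
  have hF : IsConvexSubgraph G F := ⟨fun _ hv _ hw hvw => ⟨hv, hw, hvw⟩, isConvex_hull _⟩
  have hKF : K ⊆ F.verts := (Set.subset_insert x K).trans (subset_hull _)
  have hxF : x ∈ F.verts := subset_hull _ (Set.mem_insert x K)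
  have himg : Subtype.val '' (Subtype.val ⁻¹' K : Set F.verts) = K := by
    rw [Subtype.image_preimage_coe]
    exact Set.inter_eq_right.2 hKF
  have hmax : IsMaximalProperConvex F.coe (Subtype.val ⁻¹' K) := by
    refine ⟨⟨hK.1.1.preimage_coe hc hF, fun heq => ?_⟩, fun C hC hKC => ?_⟩
    · have : (⟨x, hxF⟩ : F.verts) ∈ (Subtype.val ⁻¹' K : Set F.verts) := heq ▸ trivial
      exact hK.1.2 this
    · by_contra hCK
      apply hC.2
      have hss : K ⊂ Subtype.val '' C := by
        refine ⟨himg.symm.subset.trans (Set.image_mono hKC), fun hCK' => hCK ?_⟩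
        exact Set.image_subset_iff.1 hCK'
      have hle := hK.subset_of_ssubset ((hF.isConvex_coe_iff hc).1 hC.1) hss
      refine Set.eq_univ_of_forall fun z => ?_
      obtain ⟨w, hw, hwz⟩ := hle z.2
      rwa [← Subtype.ext hwz]
  have hhalf := (hF.isConvex_coe_iff hc).1 (h F hF _ hmax).2
  have hAtt : Att G K = Subtype.val '' (Subtype.val ⁻¹' K : Set F.verts)ᶜ := by
    rw [hK.att_eq, ← Set.preimage_compl, Subtype.image_preimage_coe]
    rfl
  rwa [hAtt]

end GeodesicConvexity

theorem propositionP {V : Type u} (G : SimpleGraph V) (hconn : G.Connected)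
    (hbip : G.IsBipartite) :
    List.TFAE [
      GeodesicConvexity.IsPartialCube G,
      GeodesicConvexity.IsAttConvex G,
      ∀ F : G.Subgraph, GeodesicConvexity.IsConvexSubgraph G F →
        ∀ K : Set F.verts, GeodesicConvexity.IsMaximalProperConvex F.coe K →
          GeodesicConvexity.IsHalfSpace F.coe K] := by
  open GeodesicConvexity in
  tfae_have 1 → 3 := fun h _ hF _ hK => h.isHalfSpace_of_isMaximalProperConvex hbip hF hK
  tfae_have 3 → 2 := isAttConvex_of_isHalfSpace hconn
  tfae_have 2 → 1 := fun h => isPartialCube_of_isConvex_nearer hconn hbip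
    fun _ _ => h.isConvex_nearer hconn hbip
  tfae_finish
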